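/- Let $\bar A\in\{0,*\}^{n\times n}$, $\bar C\in\{0,*\}^{p\times n}$, $\bar F\in\{0,*\}^{r\times n}$ be structured matrices, i.e. each entry is either a fixed zero or a free real parameter $*$, all free parameters being independent; let $n_{\bar M}$ be the number of $*$ entries of $\bar M$, and call the real matrix obtained by assigning real values to the $*$ entries a realization of $\bar M$. Let $\mathcal G(\bar A,\bar C)$ be the digraph with state vertices $x_1,\dots,x_n$, output vertices $y_1,\dots,y_p$, an edge $(x_i,x_j)$ whenever $\bar A_{ji}\neq 0$ and an edge $(x_i,y_j)$ whenever $\bar C_{ji}\neq 0$. A state vertex is output-reachable if there is a directed path in $\mathcal G(\bar A,\bar C)$ from it to some output vertex. The functional states are the $x_i$ for which the $i$-th column of $\bar F$ is nonzero. A proper variety in $\mathbb R^d$ is the set of common real zeros of a system of polynomials in $d$ variables that is not all of $\mathbb R^d$. For real matrices $A\in\mathbb R^{n\times n}$, $C\in\mathbb R^{p\times n}$, $F\in\mathbb R^{r\times n}$, put $O(A,C)=[C;CA;\dots;CA^{n-1}]$ (rows stacked). An eigenvalue $\lambda\in\mathbb C$ of $A$ is modally functionally observable if every vector $v$ of the generalized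 eigenspace $\ker (A-\lambda I)^n\subseteq\mathbb C^n$ with $O(A,C)v=0$ satisfies $Fv=0$; when the algebraic and geometric multiplicities of $\lambda$ coincide, this is the condition $\operatorname{rank}[A-\lambda I;C;F]=\operatorname{rank}[A-\lambda I;C]$. Proposition. If every functional state is output-reachable in $\mathcal G(\bar A,\bar C)$, then there is a proper variety $\mathbb V\subseteq\mathbb R^{n_{\bar A}}\times\mathbb R^{n_{\bar C}}\times\mathbb R^{n_{\bar F}}$ such that for every realization $(A,C,F)$ of $(\bar A,\bar C,\bar F)$ whose parameter vector lies outside $\mathbb V$, every nonzero eigenvalue $\lambda\in\mathbb C$ of $A$ is modally functionally observable, and $$\operatorname{rank}[A-\lambda I;C;F]=\operatorname{rank}[A-\lambda I;C].$$ -/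

import Mathlib

/-- A structured matrix: each entry is either a free parameter (`true`) or a fixed zero
(`false`). -/
abbrev StructuredMatrix (m n : ℕ) := Matrix (Fin m) (Fin n) Bool

namespace StructuredMatrix

/-- The positions of the free parameters of a structured matrix. -/
abbrev Star {m n : ℕ} (M : StructuredMatrix m n) : Type :=
  {e : Fin m × Fin n // M e.1 e.2 = true}

/-- The realization of a structured matrix at given values of its free parameters. -/
def realize {m n : ℕ} (M : StructuredMatrix m n) (θ : M.Star → ℝ) :
    Matrix (Fin m) (Fin n) ℝ :=
  Matrix.of fun i j => if h : M i j = true then θ ⟨(i, j), h⟩ else 0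

/-- The digraph on the state vertices `inl i` and the output vertices `inr j`, with an edge from
`x_i` to `x_j` iff the `(j, i)` entry of `A` is free, and an edge from `x_i` to `y_j` iff the
`(j, i)` entry of `C` is free. -/
def systemDigraph {n p : ℕ} (A : StructuredMatrix n n) (C : StructuredMatrix p n) :
    Digraph (Fin n ⊕ Fin p) where
  Adj v w := match v, w with
    | Sum.inl i, Sum.inl j => A j i = true
    | Sum.inl i, Sum.inr j => C j i = true
    | Sum.inr _, _ => False

/-- A state vertex is output-reachable if there is a directed path from it to an output vertex. -/
def OutputReachable {n p : ℕ} (A : StructuredMatrix n n) (C : StructuredMatrix p n)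
    (i : Fin n) : Prop :=
  ∃ j : Fin p, Relation.ReflTransGen (systemDigraph A C).Adj (Sum.inl i) (Sum.inr j)

/-- The functional states: those whose column of `F` is nonzero. -/
def functionalStates {n r : ℕ} (F : StructuredMatrix r n) : Set (Fin n) :=
  {i | ∃ k : Fin r, F k i = true}

end StructuredMatrix

/-- A proper variety in `ℝ^σ`: the set of common real zeros of a system of polynomials, different
from the whole space. -/
def IsProperVariety {σ : Type} (V : Set (σ → ℝ)) : Prop :=
  (∃ S : Set (MvPolynomial σ ℝ), V = {θ | ∀ f ∈ S, MvPolynomial.eval θ f = 0}) ∧ V ≠ Set.univ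

/-- A real matrix viewed as a complex matrix. -/
abbrev complexify {m n : ℕ} (M : Matrix (Fin m) (Fin n) ℝ) : Matrix (Fin m) (Fin n) ℂ :=
  M.map Complex.ofReal

/-- The observability matrix `[C; C A; …; C A ^ (n - 1)]`; its row `(k, j)` is row `j` of
`C A ^ k`. -/
def observabilityMatrix {n p : ℕ} (A : Matrix (Fin n) (Fin n) ℝ) (C : Matrix (Fin p) (Fin n) ℝ) :
    Matrix (Fin n × Fin p) (Fin n) ℝ :=
  Matrix.of fun kj => (C * A ^ (kj.1 : ℕ)) kj.2

/-- The rows of `[A - μ I; C]`. -/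
abbrev pencil {n p : ℕ} (A : Matrix (Fin n) (Fin n) ℝ) (C : Matrix (Fin p) (Fin n) ℝ) (μ : ℂ) :
    Matrix (Fin n ⊕ Fin p) (Fin n) ℂ :=
  Matrix.fromRows (complexify A - μ • (1 : Matrix (Fin n) (Fin n) ℂ)) (complexify C)

/-- The mode `μ` of `(A, C, F)` is modally functionally observable: `F` vanishes on every
unobservable vector of the generalized eigenspace of `A` at `μ`. In a Jordan basis this says
`rank [O(J, C'); F'] = rank O(J, C')`, where `J` gathers the Jordan blocks at `μ` and `C'`, `F'` are
the corresponding column blocks. If the algebraic and geometric multiplicities of `μ` agree, it is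
the rank condition `rank [A - μ I; C; F] = rank [A - μ I; C]`
(`modallyFunctionallyObservable_iff_rank`). -/
def ModallyFunctionallyObservable {n p r : ℕ} (A : Matrix (Fin n) (Fin n) ℝ)
    (C : Matrix (Fin p) (Fin n) ℝ) (F : Matrix (Fin r) (Fin n) ℝ) (μ : ℂ) : Prop :=
  ∀ x ∈ Module.End.maxGenEigenspace (Matrix.toLin' (complexify A)) μ,
    ((observabilityMatrix A C).map Complex.ofReal).mulVec x = 0 → (complexify F).mulVec x = 0

/-- Adding rows does not change the rank iff the added rows vanish on the kernel. -/
theorem rank_fromRows_eq_iff {m k n : Type} [Fintype m] [Fintype k] [Fintype n]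
    [DecidableEq n] (M : Matrix m n ℂ) (N : Matrix k n ℂ) :
    (Matrix.fromRows M N).rank = M.rank ↔ ∀ x, M.mulVec x = 0 → N.mulVec x = 0 := by
  have hle : LinearMap.ker (Matrix.fromRows M N).mulVecLin ≤ LinearMap.ker M.mulVecLin := by
    intro x hx
    rw [LinearMap.mem_ker, Matrix.mulVecLin_apply, Matrix.fromRows_mulVec] at hx
    rw [LinearMap.mem_ker, Matrix.mulVecLin_apply]
    ext i
    simpa using congrFun hx (Sum.inl i)
  have h1 := (Matrix.fromRows M N).mulVecLin.finrank_range_add_finrank_ker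
  have h2 := M.mulVecLin.finrank_range_add_finrank_ker
  constructor
  · intro h x hx
    unfold Matrix.rank at h
    have he := Submodule.eq_of_le_of_finrank_eq hle (by omega)
    have hx' : x ∈ LinearMap.ker (Matrix.fromRows M N).mulVecLin := by
      rw [he, LinearMap.mem_ker, Matrix.mulVecLin_apply]; exact hx
    rw [LinearMap.mem_ker, Matrix.mulVecLin_apply, Matrix.fromRows_mulVec] at hx'
    ext i
    simpa using congrFun hx' (Sum.inr i)
  · intro h
    have he : LinearMap.ker (Matrix.fromRows M N).mulVecLin = LinearMap.ker M.mulVecLin := by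
      refine le_antisymm hle fun x hx => ?_
      rw [LinearMap.mem_ker, Matrix.mulVecLin_apply] at hx
      rw [LinearMap.mem_ker, Matrix.mulVecLin_apply, Matrix.fromRows_mulVec, hx, h x hx]
      ext i
      cases i <;> rfl
    unfold Matrix.rank
    rw [he] at h1
    omega

/-- For a mode with equal algebraic and geometric multiplicities, modal functional observability is
the rank condition. -/
theorem modallyFunctionallyObservable_iff_rank {n p r : ℕ} (A : Matrix (Fin n) (Fin n) ℝ)
    (C : Matrix (Fin p) (Fin n) ℝ) (F : Matrix (Fin r) (Fin n) ℝ) (μ : ℂ)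
    (hμ : (complexify A).charpoly.rootMultiplicity μ =
      Module.finrank ℂ (Module.End.eigenspace (Matrix.toLin' (complexify A)) μ)) :
    ModallyFunctionallyObservable A C F μ ↔
      (Matrix.fromRows (pencil A C μ) (complexify F)).rank = (pencil A C μ).rank := by
  have hE : Module.End.maxGenEigenspace (Matrix.toLin' (complexify A)) μ =
      Module.End.eigenspace (Matrix.toLin' (complexify A)) μ := by
    symm
    refine Submodule.eq_of_le_of_finrank_eq
      (Module.End.genEigenspace_le_maximal (Matrix.toLin' (complexify A)) μ 1) ?_
    rw [LinearMap.finrank_maxGenEigenspace_eq, Matrix.charpoly_toLin', hμ]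
  rw [rank_fromRows_eq_iff]
  unfold ModallyFunctionallyObservable
  rw [hE]
  have hpow : ∀ (x : Fin n → ℂ), (complexify A).mulVec x = μ • x → ∀ k : ℕ,
      ((complexify A) ^ k).mulVec x = μ ^ k • x := by
    intro x hx k
    induction k with
    | zero => simp
    | succ k ih => rw [pow_succ, ← Matrix.mulVec_mulVec, hx, Matrix.mulVec_smul, ih, smul_smul,
        pow_succ, mul_comm]
  have hobs : ∀ (x : Fin n → ℂ) (k : Fin n) (j : Fin p),
      ((observabilityMatrix A C).map Complex.ofReal).mulVec x (k, j) =
        (complexify C).mulVec (((complexify A) ^ (k : ℕ)).mulVec x) j := by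
    intro x k j
    have h3 : complexify C * complexify A ^ (k : ℕ) = complexify (C * A ^ (k : ℕ)) := by
      have h4 := Matrix.map_mul (L := C) (M := A ^ (k : ℕ)) (f := Complex.ofRealHom)
      have h5 := map_pow (Complex.ofRealHom.mapMatrix (m := Fin n)) A (k : ℕ)
      simp only [RingHom.mapMatrix_apply] at h5
      rw [h5] at h4
      exact h4.symm
    rw [Matrix.mulVec_mulVec, h3]
    rfl
  have key : ∀ x : Fin n → ℂ, ((complexify A).mulVec x = μ • x ∧
      ((observabilityMatrix A C).map Complex.ofReal).mulVec x = 0) ↔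
      (pencil A C μ).mulVec x = 0 := by
    intro x
    have h6 : (pencil A C μ).mulVec x = 0 ↔
        (complexify A).mulVec x = μ • x ∧ (complexify C).mulVec x = 0 := by
      rw [Matrix.fromRows_mulVec, Matrix.sub_mulVec, Matrix.smul_mulVec, Matrix.one_mulVec,
        ← sub_eq_zero (a := (complexify A).mulVec x)]
      constructor
      · intro h
        exact ⟨funext fun i => congrFun h (Sum.inl i), funext fun i => congrFun h (Sum.inr i)⟩
      · rintro ⟨h, h'⟩
        rw [h, h']
        ext i
        cases i <;> rfl
    rw [h6]
    refine and_congr_right fun hx => ⟨fun h => ?_, fun h => ?_⟩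
    · rcases Nat.eq_zero_or_pos n with rfl | hn
      · rw [Subsingleton.elim x 0, Matrix.mulVec_zero]
      · ext j
        have := congrFun h (⟨0, hn⟩, j)
        rw [hobs] at this
        simpa using this
    · ext ⟨k, j⟩
      rw [hobs, hpow x hx, Matrix.mulVec_smul, h]
      simp
  refine forall_congr' fun x => ?_
  rw [← key, Module.End.mem_eigenspace_iff, Matrix.toLin'_apply, and_imp]

/-! Every edge into an output-reachable state starts at one, and C and F read only such states, so A
has a block on them that evolves by itself. A mode that is not functionally observable yields a
nonzero x supported there, an eigenvector of this block for μ with C x = 0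
(`exists_block_eigenvector_of_not_modallyFunctionallyObservable`).

Fix the support S of x and count parameters. The row of each s in S has a free entry in a column of
S, because μ x_s ≠ 0. Some edge also leaves S, towards an output or a reachable state outside S, and
its row gives one more equation, with right side 0. Each of these #S + 1 rows can be solved for a
parameter whose coefficient is a nonzero coordinate of x. After scaling one coordinate of x to 1,
all N parameters are rational functions of N - 1 quantities: the N - #S - 1 other parameters, the #S
- 1 other coordinates, and μ. By transcendence degree they satisfy a nonzero relation P_S. The
variety is the zero set of the product of the P_S over all S. -/

/-! ### Algebraic dependence by counting parameters -/

/-- More elements of `ℝ[σ]_q` than there are variables satisfy a common polynomial relation. -/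
theorem exists_relation_localizationAway {σ E : Type} [Fintype σ] [Fintype E]
    (hcard : Fintype.card σ < Fintype.card E) {q : MvPolynomial σ ℝ} (hq : q ≠ 0)
    (f : E → Localization.Away q) :
    ∃ P : MvPolynomial E ℝ, P ≠ 0 ∧ MvPolynomial.aeval f P = 0 := by
  have hM : Submonoid.powers q ≤ nonZeroDivisors (MvPolynomial σ ℝ) :=
    powers_le_nonZeroDivisors_of_noZeroDivisors hq
  have : IsDomain (Localization.Away q) := IsLocalization.isDomain_localization hM
  have hinj : Function.Injective (algebraMap (MvPolynomial σ ℝ) (Localization.Away q)) :=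
    IsLocalization.injective _ hM
  have : FaithfulSMul (MvPolynomial σ ℝ) (Localization.Away q) :=
    (faithfulSMul_iff_algebraMap_injective _ _).2 hinj
  have : Algebra.IsAlgebraic (MvPolynomial σ ℝ) (Localization.Away q) :=
    IsLocalization.isAlgebraic _ (Submonoid.powers q)
  have htr : Algebra.trdeg ℝ (Localization.Away q) = Fintype.card σ := by
    rw [← trdeg_add_eq ℝ (MvPolynomial σ ℝ) (A := Localization.Away q),
      MvPolynomial.trdeg_of_isDomain, trdeg_eq_zero (R := MvPolynomial σ ℝ)]
    simp
  by_contra! hP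
  have hf : AlgebraicIndependent ℝ f :=
    algebraicIndependent_iff.2 fun P h0 => by_contra fun hne => hP P hne h0
  have := hf.cardinalMk_le_trdeg
  rw [htr, Cardinal.mk_fintype, Nat.cast_le] at this
  omega

/-- Consider linear equations `∑ θ e * x (col e) = c`, the sum running over the parameters `e` of
a row. If the vectors `x` are supported on `S` and the equations hold in `#S + 1` rows, with
`c = μ * x s` in the row indexed by `s ∈ S` and `c = 0` in the remaining row, then the parameters
satisfy a fixed polynomial relation. -/
theorem exists_relation_of_support {E I K : Type} [Fintype E] [DecidableEq E] [DecidableEq I]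
    [DecidableEq K] (row : E → K) (col : E → I) (S : Finset I) (i₀ : I) (hi₀ : i₀ ∈ S)
    (piv : Option S → E) (hinj : Function.Injective (row ∘ piv)) (hcol : ∀ o, col (piv o) ∈ S) :
    ∃ P : MvPolynomial E ℝ, P ≠ 0 ∧ ∀ (θ : E → ℂ) (x : I → ℂ) (μ : ℂ), μ ≠ 0 →
      (∀ i, x i ≠ 0 ↔ i ∈ S) → x i₀ = 1 →
      (∀ o, ∑ e with row e = row (piv o), θ e * x (col e) =
        o.elim 0 fun s => μ * x s) →
      MvPolynomial.aeval θ P = 0 := by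
  classical
  -- Since x i₀ = 1, the slot of i₀ carries μ instead; the count is #S + (#E - #S - 1) = #E - 1.
  let σ : Type := S ⊕ {e : E // e ∉ Set.range piv}
  have hpinj : Function.Injective piv := hinj.of_comp
  have hcard : Fintype.card σ < Fintype.card E := by
    have h1 : Fintype.card {e : E // e ∈ Set.range piv} = Fintype.card (Option S) :=
      Set.card_range_of_injective hpinj
    have h2 := Fintype.card_subtype_compl (fun e : E => e ∈ Set.range piv)
    have h3 := Fintype.card_subtype_le (fun e : E => e ∈ Set.range piv)
    rw [Fintype.card_option] at h1
    simp only [σ, Fintype.card_sum]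
    omega
  -- Inverting these variables makes every pivot coefficient a unit, so one relation serves all (θ,
  -- x, μ).
  let q : MvPolynomial σ ℝ := ∏ s : S, MvPolynomial.X (Sum.inl s)
  have hq : q ≠ 0 := Finset.prod_ne_zero_iff.2 fun s _ => MvPolynomial.X_ne_zero _
  let B := Localization.Away q
  let U : σ → B := fun v => algebraMap (MvPolynomial σ ℝ) B (MvPolynomial.X v)
  have hU : ∀ s : S, IsUnit (U (Sum.inl s)) := fun s =>
    isUnit_of_dvd_unit (map_dvd _ (Finset.dvd_prod_of_mem
      (fun s : S => (MvPolynomial.X (Sum.inl s) : MvPolynomial σ ℝ)) (Finset.mem_univ s)))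
      (IsLocalization.Away.algebraMap_isUnit q)
  let xB : I → B := fun i => if h : i ∈ S then (if i = i₀ then 1 else U (Sum.inl ⟨i, h⟩)) else 0
  let μB : B := U (Sum.inl ⟨i₀, hi₀⟩)
  have hxB : ∀ o, ∃ y, xB (col (piv o)) * y = 1 := by
    intro o
    apply IsUnit.exists_right_inv
    simp only [xB, dif_pos (hcol o)]
    split_ifs
    · exact isUnit_one
    · exact hU _
  choose y hy using hxB
  let t : E → B := fun e => if h : e ∉ Set.range piv then U (Sum.inr ⟨e, h⟩) else 0
  -- Each pivot row is solved for its pivot. The value 0 of `t` at pivots never enters: pivots lie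
  -- in distinct rows.
  let f : E → B := fun e => if h : e ∈ Set.range piv then
      y h.choose * ((h.choose.elim 0 fun s => μB * xB s) -
        ∑ e' with row e' = row e ∧ e' ≠ e, t e' * xB (col e'))
    else t e
  obtain ⟨P, hP, hPf⟩ := exists_relation_localizationAway hcard hq f
  refine ⟨P, hP, fun θ x μ hμ hx hx₀ heq => ?_⟩
  let z : σ → ℂ := Sum.elim (fun s => if (s : I) = i₀ then μ else x s) fun e => θ e
  have hz : ∀ s : S, z (Sum.inl s) ≠ 0 := by
    intro s
    simp only [z, Sum.elim_inl]
    split_ifs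
    · exact hμ
    · exact (hx s).2 s.2
  have hunit : ∀ w : Submonoid.powers q,
      IsUnit (MvPolynomial.aeval (R := ℝ) z (w : MvPolynomial σ ℝ)) := by
    rintro ⟨_, k, rfl⟩
    simp only [map_pow, q, map_prod, MvPolynomial.aeval_X]
    exact (Finset.prod_ne_zero_iff.2 fun s _ => hz s).isUnit.pow k
  let g : B →ₐ[ℝ] ℂ := IsLocalization.liftAlgHom (M := Submonoid.powers q) (S := B) hunit
  have hgU : ∀ v, g (U v) = z v := by
    intro v
    change IsLocalization.lift _ _ = _
    rw [IsLocalization.lift_eq]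
    exact MvPolynomial.aeval_X _ _
  have hgx : ∀ i, g (xB i) = x i := by
    intro i
    by_cases h : i ∈ S
    · by_cases h' : i = i₀
      · simp [xB, h', hi₀, hx₀]
      · simp only [xB, dif_pos h, if_neg h', hgU]
        simp [z, h']
    · simp only [xB, dif_neg h, map_zero]
      exact (not_not.1 (mt (hx i).1 h)).symm
  have hgμ : g μB = μ := by
    rw [hgU]
    simp [z]
  have hgt : ∀ e, e ∉ Set.range piv → g (t e) = θ e := by
    intro e he
    simp only [t, dif_pos he, hgU]
    rfl
  have hgf : ∀ e, g (f e) = θ e := by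
    intro e
    by_cases he : e ∈ Set.range piv
    · have ho := he.choose_spec
      simp only [f, dif_pos he]
      generalize he.choose = o at ho
      subst ho
      have hsum := heq o
      rw [← Finset.add_sum_erase _ _
        (Finset.mem_filter_univ (p := fun e => row e = row (piv o)) (piv o) |>.2 rfl)] at hsum
      have hrest : g (∑ e' with row e' = row (piv o) ∧ e' ≠ piv o, t e' * xB (col e')) =
          ∑ e' ∈ ({e' | row e' = row (piv o)} : Finset E).erase (piv o), θ e' * x (col e') := by
        rw [map_sum]
        refine Finset.sum_congr (by ext; simp [and_comm]) fun e' he' => ?_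
        rw [map_mul, hgx, hgt]
        rintro ⟨o', rfl⟩
        simp only [Finset.mem_erase, Finset.mem_filter] at he'
        exact he'.1 (congrArg piv (hinj he'.2.2))
      have hrhs : g (o.elim 0 fun s => μB * xB s) = o.elim 0 fun s => μ * x s := by
        cases o <;> simp [hgμ, hgx]
      have hyx : x (col (piv o)) * g (y o) = 1 := by
        rw [← hgx, ← map_mul, hy, map_one]
      rw [map_mul, map_sub, hrest, hrhs]
      linear_combination (-g (y o)) * hsum + θ (piv o) * hyx
    · simp only [f, dif_neg he]
      exact hgt e he
  have := congrArg g hPf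
  rw [map_zero, ← AlgHom.comp_apply, MvPolynomial.comp_aeval] at this
  simpa only [hgf] using this

/-! ### Unobservable vectors and generalized eigenspaces -/

theorem observabilityMatrix_mulVec_eq_zero {n p : ℕ} {A : Matrix (Fin n) (Fin n) ℝ}
    {C : Matrix (Fin p) (Fin n) ℝ} {x : Fin n → ℂ} :
    ((observabilityMatrix A C).map Complex.ofReal).mulVec x = 0 ↔
      ∀ k < n, (complexify C).mulVec ((complexify A ^ k).mulVec x) = 0 := by
  have hobs : ∀ (k : Fin n) (j : Fin p),
      ((observabilityMatrix A C).map Complex.ofReal).mulVec x (k, j) =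
        (complexify C).mulVec ((complexify A ^ (k : ℕ)).mulVec x) j := by
    intro k j
    have h3 : complexify C * complexify A ^ (k : ℕ) = complexify (C * A ^ (k : ℕ)) := by
      have h4 := Matrix.map_mul (L := C) (M := A ^ (k : ℕ)) (f := Complex.ofRealHom)
      have h5 := map_pow (Complex.ofRealHom.mapMatrix (m := Fin n)) A (k : ℕ)
      simp only [RingHom.mapMatrix_apply] at h5
      rw [h5] at h4
      exact h4.symm
    rw [Matrix.mulVec_mulVec, h3]
    rfl
  constructor
  · intro h k hk
    ext j
    rw [← hobs ⟨k, hk⟩, h]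
    rfl
  · intro h
    ext ⟨k, j⟩
    rw [hobs, h k k.2]
    rfl

/-- Unobservability does not depend on the number of output derivatives taken, once it is at least
the dimension. -/
theorem mulVec_pow_mulVec_eq_zero {n p : ℕ} {M : Matrix (Fin n) (Fin n) ℂ}
    {N : Matrix (Fin p) (Fin n) ℂ} {x : Fin n → ℂ}
    (h : ∀ k < n, N.mulVec ((M ^ k).mulVec x) = 0) (k : ℕ) :
    N.mulVec ((M ^ k).mulVec x) = 0 := by
  rcases Nat.eq_zero_or_pos n with rfl | hn
  · rw [Subsingleton.elim ((M ^ k).mulVec x) 0, Matrix.mulVec_zero]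
  have : Nonempty (Fin n) := ⟨⟨0, hn⟩⟩
  -- By Cayley–Hamilton, `M ^ k` is the remainder of `X ^ k` modulo the characteristic polynomial,
  -- evaluated at M.
  have hdeg : (Polynomial.X ^ k %ₘ M.charpoly).natDegree < n := by
    have h1 := Polynomial.natDegree_modByMonic_lt (Polynomial.X ^ k : Polynomial ℂ)
      M.charpoly_monic fun h0 => by
        have := congrArg Polynomial.natDegree h0
        rw [M.charpoly_natDegree_eq_dim] at this
        simp at this
        omega
    simpa [M.charpoly_natDegree_eq_dim] using h1
  rw [M.pow_eq_aeval_mod_charpoly, Polynomial.aeval_eq_sum_range' hdeg, Matrix.sum_mulVec,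
    Matrix.mulVec_sum]
  refine Finset.sum_eq_zero fun i hi => ?_
  rw [Matrix.smul_mulVec, Matrix.mulVec_smul, h i (Finset.mem_range.1 hi), smul_zero]

/-- If a mode is not functionally observable, then there is a nonzero vector supported in the
block `R` of states that are not driven by the other ones, on which the block of `A` acts by the
eigenvalue, and which has zero output. -/
theorem exists_block_eigenvector_of_not_modallyFunctionallyObservable {n p r : ℕ}
    {A : Matrix (Fin n) (Fin n) ℝ} {C : Matrix (Fin p) (Fin n) ℝ} {F : Matrix (Fin r) (Fin n) ℝ}
    (R : Set (Fin n)) (hA : ∀ j ∈ R, ∀ i ∉ R, A j i = 0) (hC : ∀ j, ∀ i ∉ R, C j i = 0)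
    (hF : ∀ j, ∀ i ∉ R, F j i = 0) {μ : ℂ} (h : ¬ ModallyFunctionallyObservable A C F μ) :
    ∃ x : Fin n → ℂ, x ≠ 0 ∧ (∀ i ∉ R, x i = 0) ∧
      (∀ j ∈ R, (complexify A).mulVec x j = μ * x j) ∧ (complexify C).mulVec x = 0 := by
  classical
  unfold ModallyFunctionallyObservable at h
  push Not at h
  obtain ⟨v, hv, hO, hFv⟩ := h
  set T := Matrix.toLin' (complexify A) - μ • (1 : Module.End ℂ (Fin n → ℂ)) with hT
  obtain ⟨m, hm⟩ := (Module.End.mem_maxGenEigenspace _ _ _).1 hv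
  have hTapp : ∀ w, T w = (complexify A).mulVec w - μ • w := fun w => by simp [hT]
  have hCT : ∀ m k, (complexify C).mulVec ((complexify A ^ k).mulVec ((T ^ m) v)) = 0 := by
    intro m
    induction m with
    | zero => exact mulVec_pow_mulVec_eq_zero (observabilityMatrix_mulVec_eq_zero.1 hO)
    | succ m ih =>
      intro k
      rw [pow_succ', Module.End.mul_apply, hTapp, Matrix.mulVec_sub, Matrix.mulVec_smul,
        Matrix.mulVec_mulVec, ← pow_succ, Matrix.mulVec_sub, Matrix.mulVec_smul, ih, ih]
      simp
  -- At the least such m, the preceding iterate is nonzero on R and T sends it to zero there. This m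
  -- is positive because F sees only R and F v ≠ 0.
  have hex : ∃ m, ∀ i ∈ R, (T ^ m) v i = 0 := ⟨m, fun i _ => by rw [hm]; rfl⟩
  have hblock : ∀ {l : ℕ} (M : Matrix (Fin l) (Fin n) ℝ) (j : Fin l), (∀ i ∉ R, M j i = 0) →
      ∀ w : Fin n → ℂ, (complexify M).mulVec (R.indicator w) j = (complexify M).mulVec w j := by
    intro l M j hM w
    simp only [Matrix.mulVec, dotProduct]
    refine Finset.sum_congr rfl fun i _ => ?_
    by_cases hi : i ∈ R
    · rw [Set.indicator_of_mem hi]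
    · simp [hM i hi]
  have hpos : Nat.find hex ≠ 0 := by
    intro h0
    have h1 := Nat.find_spec hex
    rw [h0] at h1
    apply hFv
    ext j
    rw [← hblock F j (hF j), show R.indicator v = 0 from
      Set.indicator_eq_zero.2 (Set.disjoint_left.2 fun i hi hiR => hi (h1 i hiR)),
      Matrix.mulVec_zero]
  obtain ⟨k, hk⟩ := Nat.exists_eq_succ_of_ne_zero hpos
  have hspec := Nat.find_spec hex
  have hmin := Nat.find_min hex (m := k) (by omega)
  rw [hk] at hspec
  push Not at hmin
  obtain ⟨i, hiR, hi⟩ := hmin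
  refine ⟨R.indicator ((T ^ k) v), fun h0 => hi ?_, fun i hi => Set.indicator_of_notMem hi _,
    fun j hj => ?_, ?_⟩
  · rw [← Set.indicator_of_mem hiR ((T ^ k) v), h0]
    rfl
  · have := hspec j hj
    rw [pow_succ', Module.End.mul_apply, hTapp] at this
    rw [hblock A j (hA j hj), Set.indicator_of_mem hj]
    simpa [sub_eq_zero] using this
  · ext j
    rw [hblock C j (hC j)]
    simpa using congrFun (hCT k 0) j

/-- Modal functional observability implies the rank condition. -/
theorem ModallyFunctionallyObservable.rank_eq {n p r : ℕ} {A : Matrix (Fin n) (Fin n) ℝ}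
    {C : Matrix (Fin p) (Fin n) ℝ} {F : Matrix (Fin r) (Fin n) ℝ} {μ : ℂ}
    (h : ModallyFunctionallyObservable A C F μ) :
    (Matrix.fromRows (pencil A C μ) (complexify F)).rank = (pencil A C μ).rank := by
  rw [rank_fromRows_eq_iff]
  intro x hx
  rw [Matrix.fromRows_mulVec, Matrix.sub_mulVec, Matrix.smul_mulVec, Matrix.one_mulVec] at hx
  have hAx : (complexify A).mulVec x = μ • x :=
    sub_eq_zero.1 (funext fun i => congrFun hx (Sum.inl i))
  have hCx : (complexify C).mulVec x = 0 := funext fun i => congrFun hx (Sum.inr i)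
  have hpow : ∀ k : ℕ, (complexify A ^ k).mulVec x = μ ^ k • x := by
    intro k
    induction k with
    | zero => simp
    | succ k ih => rw [pow_succ, ← Matrix.mulVec_mulVec, hAx, Matrix.mulVec_smul, ih, smul_smul,
        pow_succ, mul_comm]
  refine h x ((Module.End.mem_maxGenEigenspace _ _ _).2 ⟨1, ?_⟩)
    (observabilityMatrix_mulVec_eq_zero.2 fun k _ => ?_)
  · simp [hAx]
  · rw [hpow, Matrix.mulVec_smul, hCx, smul_zero]

/-! ### Structured matrices and their digraph -/

namespace StructuredMatrix

theorem realize_apply_of_eq_false {m n : ℕ} (M : StructuredMatrix m n) (θ : M.Star → ℝ)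
    {i : Fin m} {j : Fin n} (h : M i j ≠ true) : M.realize θ i j = 0 := by
  simp only [realize, Matrix.of_apply, dif_neg h]

theorem complexify_realize_mulVec {m n : ℕ} (M : StructuredMatrix m n) (θ : M.Star → ℝ)
    (x : Fin n → ℂ) (i : Fin m) :
    (complexify (M.realize θ)).mulVec x i =
      ∑ e : M.Star, if e.1.1 = i then (θ e : ℂ) * x e.1.2 else 0 := by
  let g : Fin m × Fin n → ℂ := fun e =>
    if e.1 = i then (M.realize θ e.1 e.2 : ℂ) * x e.2 else 0
  have h1 : ∀ e : M.Star, (if e.1.1 = i then (θ e : ℂ) * x e.1.2 else 0) = g e := by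
    rintro ⟨e, he⟩
    simp only [g, realize, Matrix.of_apply, dif_pos he]
  rw [Finset.sum_congr rfl fun e _ => h1 e,
    ← Finset.sum_subtype (Finset.univ.filter fun e : Fin m × Fin n => M e.1 e.2 = true)
      (by simp) g, Finset.sum_filter_of_ne, Fintype.sum_prod_type, Finset.sum_eq_single i]
  · simp [g, Matrix.mulVec, dotProduct]
  · intro b _ hb
    simp [g, hb]
  · simp
  · intro e _ he
    by_contra h
    exact he (by simp [g, realize_apply_of_eq_false M θ h])

variable {n p : ℕ}

/-- The vertex to which the edge given by a free parameter points. -/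
def edgeTarget (A : StructuredMatrix n n) (C : StructuredMatrix p n) :
    A.Star ⊕ C.Star → Fin n ⊕ Fin p :=
  Sum.elim (fun a => Sum.inl a.1.1) fun c => Sum.inr c.1.1

/-- The state vertex from which the edge given by a free parameter starts. -/
def edgeSource (A : StructuredMatrix n n) (C : StructuredMatrix p n) :
    A.Star ⊕ C.Star → Fin n :=
  Sum.elim (fun a => a.1.2) fun c => c.1.2

/-- State and output equations become rows of one linear system in the parameters, as
`exists_relation_of_support` needs. -/
theorem sum_edgeTarget_inl (A : StructuredMatrix n n) (C : StructuredMatrix p n)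
    (θ : A.Star ⊕ C.Star → ℝ) (x : Fin n → ℂ) (j : Fin n) :
    ∑ e with edgeTarget A C e = Sum.inl j, (θ e : ℂ) * x (edgeSource A C e) =
      (complexify (A.realize fun a => θ (Sum.inl a))).mulVec x j := by
  rw [Finset.sum_filter, Fintype.sum_sum_type]
  simp [complexify_realize_mulVec, edgeTarget, edgeSource]

theorem sum_edgeTarget_inr (A : StructuredMatrix n n) (C : StructuredMatrix p n)
    (θ : A.Star ⊕ C.Star → ℝ) (x : Fin n → ℂ) (j : Fin p) :
    ∑ e with edgeTarget A C e = Sum.inr j, (θ e : ℂ) * x (edgeSource A C e) =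
      (complexify (C.realize fun c => θ (Sum.inr c))).mulVec x j := by
  rw [Finset.sum_filter, Fintype.sum_sum_type]
  simp [complexify_realize_mulVec, edgeTarget, edgeSource]

theorem OutputReachable.of_edge {A : StructuredMatrix n n} {C : StructuredMatrix p n}
    {i j : Fin n} (hj : OutputReachable A C j) (h : A j i = true) : OutputReachable A C i :=
  let ⟨k, hk⟩ := hj
  ⟨k, Relation.ReflTransGen.head (a := Sum.inl i) (b := Sum.inl j) h hk⟩

theorem outputReachable_of_output {A : StructuredMatrix n n} {C : StructuredMatrix p n}
    {i : Fin n} {j : Fin p} (h : C j i = true) : OutputReachable A C i :=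
  ⟨j, Relation.ReflTransGen.single (a := Sum.inl i) (b := Sum.inr j) h⟩

/-- An edge leads out of every set of states that contains an output-reachable one, to an output
or to another output-reachable state. -/
theorem OutputReachable.exists_exit {A : StructuredMatrix n n} {C : StructuredMatrix p n}
    {i : Fin n} (hi : OutputReachable A C i) {S : Finset (Fin n)} (hS : i ∈ S) :
    ∃ e, edgeSource A C e ∈ S ∧
      ∀ j, edgeTarget A C e = Sum.inl j → j ∉ S ∧ OutputReachable A C j := by
  obtain ⟨k, hk⟩ := hi
  suffices H : ∀ v, Relation.ReflTransGen (systemDigraph A C).Adj v (Sum.inr k) →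
      ∀ i ∈ S, v = Sum.inl i → ∃ e, edgeSource A C e ∈ S ∧
        ∀ j, edgeTarget A C e = Sum.inl j → j ∉ S ∧ OutputReachable A C j from
    H _ hk i hS rfl
  intro v hv
  induction hv using Relation.ReflTransGen.head_induction_on with
  | refl => simp
  | head h hw ih =>
    rintro i hi rfl
    rename_i w
    rcases w with j | j
    -- If the path leaves S here, its remainder witnesses that j is reachable.
    · by_cases hj : j ∈ S
      · exact ih j hj rfl
      · refine ⟨Sum.inl ⟨(j, i), h⟩, hi, fun j' hj' => ?_⟩
        obtain rfl : j = j' := by simpa [edgeTarget] using hj'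
        exact ⟨hj, k, hw⟩
    · exact ⟨Sum.inr ⟨(j, i), h⟩, hi, by simp [edgeTarget]⟩

/-- The parameters for which some vector with support `S`, consisting of output-reachable states,
is an unobservable eigenvector of the output-reachable part for a nonzero eigenvalue satisfy a
fixed polynomial relation. -/
theorem exists_relation_of_unobservable_support (A : StructuredMatrix n n)
    (C : StructuredMatrix p n) (S : Finset (Fin n)) :
    ∃ P : MvPolynomial (A.Star ⊕ C.Star) ℝ, P ≠ 0 ∧
      ∀ (θ : A.Star ⊕ C.Star → ℂ) (x : Fin n → ℂ) (μ : ℂ), μ ≠ 0 → x ≠ 0 →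
        (∀ i, x i ≠ 0 ↔ i ∈ S) → (∀ i, ¬ OutputReachable A C i → x i = 0) →
        (∀ j, OutputReachable A C j →
          ∑ e with edgeTarget A C e = Sum.inl j, θ e * x (edgeSource A C e) = μ * x j) →
        (∀ j, ∑ e with edgeTarget A C e = Sum.inr j, θ e * x (edgeSource A C e) = 0) →
        MvPolynomial.aeval θ P = 0 := by
  by_cases hS : (∃ i, i ∈ S) ∧ (∀ i ∈ S, OutputReachable A C i) ∧
      ∀ s : S, ∃ e, edgeTarget A C e = Sum.inl s.1 ∧ edgeSource A C e ∈ S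
  · obtain ⟨⟨i₀, hi₀⟩, hSR, hrow⟩ := hS
    choose piv hpiv hpivS using hrow
    obtain ⟨e₀, he₀S, he₀⟩ := (hSR i₀ hi₀).exists_exit hi₀
    have hinj : Function.Injective (edgeTarget A C ∘ fun o : Option S => o.elim e₀ piv) := by
      rintro (_ | s) (_ | t) h
      · rfl
      · exact absurd t.2 (he₀ t (h.trans (hpiv t))).1
      · exact absurd s.2 (he₀ s (h.symm.trans (hpiv s))).1
      · have := (hpiv s).symm.trans (h.trans (hpiv t))
        rw [Subtype.ext (Sum.inl_injective this)]
    obtain ⟨P, hP, hPθ⟩ := exists_relation_of_support (edgeTarget A C) (edgeSource A C) S i₀ hi₀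
      (fun o => o.elim e₀ piv) hinj (by rintro (_ | s); exacts [he₀S, hpivS s])
    refine ⟨P, hP, fun θ x μ hμ _ hx hxR hA hC => ?_⟩
    have hx₀ : x i₀ ≠ 0 := (hx i₀).2 hi₀
    -- The equations are homogeneous in x, so x can be scaled to have x i₀ = 1.
    have hscale : ∀ k k', k' = k →
        ∑ e with edgeTarget A C e = k', θ e * (x (edgeSource A C e) / x i₀) =
          (∑ e with edgeTarget A C e = k, θ e * x (edgeSource A C e)) / x i₀ := by
      rintro k _ rfl
      rw [Finset.sum_div]
      exact Finset.sum_congr rfl fun e _ => (mul_div_assoc _ _ _).symm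
    refine hPθ θ (fun i => x i / x i₀) μ hμ (fun i => ?_) (div_self hx₀) ?_
    · rw [← hx i]
      simp [hx₀]
    · rintro (_ | s)
      · rcases hk : edgeTarget A C e₀ with j | j
        · obtain ⟨hjS, hj⟩ := he₀ j hk
          refine (hscale _ _ hk).trans ?_
          rw [hA j hj, not_not.1 (mt (hx j).1 hjS)]
          simp
        · refine (hscale _ _ hk).trans ?_
          rw [hC, zero_div]
          rfl
      · refine (hscale _ _ (hpiv s)).trans ?_
        rw [hA s (hSR s s.2), mul_div_assoc]
        rfl
  -- No vector has such a support, so P = 1 works. In particular, a row s without free entry in S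
  -- would give 0 = μ x_s; here μ ≠ 0 is essential.
  · refine ⟨1, one_ne_zero, fun θ x μ hμ hx0 hx hxR hA hC => (hS ⟨?_, ?_, ?_⟩).elim⟩
    · obtain ⟨i, hi⟩ := Function.ne_iff.1 hx0
      exact ⟨i, (hx i).1 hi⟩
    · exact fun i hi => by_contra fun h => (hx i).2 hi (hxR i h)
    · intro s
      by_contra! h
      have hs := (hx s).2 s.2
      have hR := hA s (by_contra fun h => hs (hxR s h))
      rw [Finset.sum_eq_zero] at hR
      · exact mul_ne_zero hμ hs hR.symm
      · intro e he
        rw [not_not.1 (mt (hx _).1 (h e (Finset.mem_filter.1 he).2)), mul_zero]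

end StructuredMatrix

/-! ### The proper variety -/

theorem mainTheorem12 {n p r : ℕ} (A : StructuredMatrix n n) (C : StructuredMatrix p n)
    (F : StructuredMatrix r n)
    (hreach : ∀ i ∈ F.functionalStates, StructuredMatrix.OutputReachable A C i) :
    ∃ V : Set (A.Star ⊕ C.Star ⊕ F.Star → ℝ), IsProperVariety V ∧
      ∀ θ : A.Star ⊕ C.Star ⊕ F.Star → ℝ, θ ∉ V →
        ∀ (A₀ : Matrix (Fin n) (Fin n) ℝ) (C₀ : Matrix (Fin p) (Fin n) ℝ)
          (F₀ : Matrix (Fin r) (Fin n) ℝ),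
          A₀ = A.realize (fun a => θ (Sum.inl a)) →
          C₀ = C.realize (fun c => θ (Sum.inr (Sum.inl c))) →
          F₀ = F.realize (fun f => θ (Sum.inr (Sum.inr f))) →
          ∀ μ : ℂ, μ ≠ 0 → Module.End.HasEigenvalue (Matrix.toLin' (complexify A₀)) μ →
            ModallyFunctionallyObservable A₀ C₀ F₀ μ ∧
              (Matrix.fromRows (pencil A₀ C₀ μ) (complexify F₀)).rank =
                (pencil A₀ C₀ μ).rank := by
  choose P hP hPθ using StructuredMatrix.exists_relation_of_unobservable_support A C
  let ι : A.Star ⊕ C.Star → A.Star ⊕ C.Star ⊕ F.Star := Sum.map id Sum.inl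
  have hι : Function.Injective ι := Function.injective_id.sumMap Sum.inl_injective
  let Q : MvPolynomial (A.Star ⊕ C.Star ⊕ F.Star) ℝ := MvPolynomial.rename ι (∏ S, P S)
  have hQ : Q ≠ 0 := (map_ne_zero_iff _ (MvPolynomial.rename_injective ι hι)).2
    (Finset.prod_ne_zero_iff.2 fun S _ => hP S)
  refine ⟨{θ | ∀ f ∈ ({Q} : Set _), MvPolynomial.eval θ f = 0}, ⟨⟨_, rfl⟩, fun h => hQ ?_⟩, ?_⟩
  · refine MvPolynomial.funext fun θ => ?_
    have hθ := h.symm ▸ Set.mem_univ θ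
    simpa using hθ
  rintro θ hθ A₀ C₀ F₀ hA₀ hC₀ hF₀ μ hμ -
  suffices H : ModallyFunctionallyObservable A₀ C₀ F₀ μ from ⟨H, H.rank_eq⟩
  by_contra hobs
  obtain ⟨x, hx0, hxR, hAx, hCx⟩ :=
    exists_block_eigenvector_of_not_modallyFunctionallyObservable
      {i | StructuredMatrix.OutputReachable A C i}
      (fun j hj i hi => hA₀ ▸ A.realize_apply_of_eq_false _ fun h => hi (hj.of_edge h))
      (fun j i hi => hC₀ ▸ C.realize_apply_of_eq_false _ fun h =>
        hi (StructuredMatrix.outputReachable_of_output h))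
      (fun j i hi => hF₀ ▸ F.realize_apply_of_eq_false _ fun h => hi (hreach i ⟨j, h⟩)) hobs
  classical
  have hzero := hPθ {i | x i ≠ 0} (fun e => (θ (ι e) : ℂ)) x μ hμ hx0 (by simp) hxR
    (fun j hj => by
      rw [StructuredMatrix.sum_edgeTarget_inl A C (fun e => θ (ι e)), ← hAx j hj, hA₀]
      rfl)
    (fun j => by
      rw [StructuredMatrix.sum_edgeTarget_inr A C (fun e => θ (ι e))]
      exact hC₀ ▸ congrFun hCx j)
  apply hθ
  rintro _ rfl
  rw [MvPolynomial.eval_rename, map_prod]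
  refine Finset.prod_eq_zero (Finset.mem_univ (Finset.univ.filter fun i => x i ≠ 0)) ?_
  -- x and μ are complex, but P and θ are real, so the relation descends to ℝ.
  have hcast := MvPolynomial.aeval_algebraMap_apply ℂ (fun e => θ (ι e))
    (P (Finset.univ.filter fun i => x i ≠ 0))
  exact Complex.ofReal_injective (hcast.symm.trans (hzero.trans Complex.ofReal_zero.symm))
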